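/- **Setting.** For $\alpha\in\mathbb N^n$ write $x^\alpha=x_1^{\alpha_1}\cdots x_n^{\alpha_n}$ for the corresponding standard monomial of a free associative algebra in $x_1,\dots,x_n$; a standard polynomial is a linear combination $f=\sum_\alpha c_\alpha x^\alpha$ of standard monomials, and $\mathcal N(f)=\{\alpha\mid c_\alpha\neq 0\}$. A monomial ordering is a total ordering $>$ on $\mathbb N^n$ which is a well-ordering and satisfies $\alpha>\beta\Rightarrow\alpha+\gamma>\beta+\gamma$; for $f\ne 0$, $\exp(f)$ is the largest element of $\mathcal N(f)$. Let $\epsilon_i$ be the $i$-th unit vector. For $\omega\in\mathbb N^n$, $f$ is $\omega$-homogeneous of degree $d$ if $\sum_i\omega_i\alpha_i=d$ for all $\alpha\in\mathcal N(f)$. A $G$-algebra over a field $K$ is an algebra $$A=K\langle x_1,\dots,x_n\mid x_jx_i=c_{ij}\,x_ix_j+d_{ij},\ 1\le i<j\le n\rangle$$ with $0\ne c_{ij}\in K$ and standard polynomials $d_{ij}$ such that (i) there is a monomial ordering, called admissible for $A$, with $d_{ij}=0$ or $\epsilon_i+\epsilon_j>\exp(d_{ij})$ for all $i<j$; and (ii)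 for all $i<j<k$ the element $$c_{ik}c_{jk}\,d_{ij}x_k-x_kd_{ij}+c_{jk}\,x_jd_{ik}-c_{ij}\,d_{ik}x_j+d_{jk}x_i-c_{ij}c_{ik}\,x_id_{jk}$$ of the free algebra can be rewritten to $0$ by finitely many applications of the relations $x_jx_i\to c_{ij}x_ix_j+d_{ij}$ $(i<j)$ to the words occurring in it. The standard monomials then form a $K$-basis of $A$, so that $\mathcal N(f)$, the coefficients of $f$, $\exp(f)$ and $\omega$-homogeneity make sense for $f\in A$. Fix an admissible ordering. For $T\subset A$ let $\exp(T)=\{\exp(f)\mid f\in T\setminus\{0\}\}$, and let $\langle T\rangle$ be the left ideal generated by $T$. A finite set $\mathcal G\subset I\setminus\{0\}$ is a (left) Gröbner basis for a left ideal $I$ if $\exp(I)=\bigcup_{g\in\mathcal G}(\exp(g)+\mathbb N^n)$ (so the zero ideal has the empty Gröbner basis), and a finite set $\mathcal G\subset A\setminus\{0\}$ is a left Gröbner basis if it is one for $\langle\mathcal G\rangle$. A Gröbner basis $\mathcal G$ for $I$ is reduced if its elements have leading coefficient $1$ and, for distinct $g,h\in\mathcal G$, no $\alpha\in\mathcal N(g)$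 lies in $\exp(h)+\mathbb N^n$. **Theorem.** Let $A$ be a $G$-algebra over $\mathbb Q$ whose relations have integer coefficients, i.e. $c_{ij}\in\mathbb Z$ and the $d_{ij}$ have coefficients in $\mathbb Z$, and let $>$ be an admissible ordering for $A$. Let $\omega\in\mathbb N_{\ge1}^n$ be such that $d_{ij}$ is $\omega$-homogeneous of degree $\omega_i+\omega_j$ for all $i<j$. Let $I=\langle f_1,\dots,f_r\rangle\subset A$, where the $f_j$ are $\omega$-homogeneous with integer coefficients. For a prime $p$ that divides no $c_{ij}$ and no nonzero coefficient of any $d_{ij}$ $(i<j)$, let $A_p$ be the $G$-algebra over $\mathbb F_p$ obtained by reducing the relations modulo $p$, let $\tilde I_p\subset A_p$ be the left ideal generated by the reductions of $f_1,\dots,f_r$ modulo $p$, and let $\mathcal G(p)$ be the reduced Gröbner basis for $\tilde I_p$ with respect to $>$. Let $\mathcal G\subset A$ be a finite set such that 1. $\exp(\mathcal G)=\exp(\mathcal G(p))$ for some such prime $p$, 2. $\mathcal G$ is a left Gröbner basis, and 3. $I\subset\langle\mathcal G\rangle$. Then $\mathcal G$ is a Gröbner basis for $I$. -/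

import Mathlib

/-- The free associative algebra `R⟨x₁, …, xₙ⟩`, i.e. the monoid algebra of the free monoid of words
in `x₁, …, xₙ`. -/
abbrev FreeAlg (R : Type) [CommRing R] (n : ℕ) : Type :=
  MonoidAlgebra R (FreeMonoid (Fin n))

/-- Standard polynomials, `R`-linear combinations of the standard monomials `x₁^α₁ ⋯ xₙ^αₙ`, stored as
their families of coefficients (finitely supported functions of `α ∈ ℕⁿ`). Only the `R`-module
structure, the coefficients and the support (the Newton diagram) of `MvPolynomial` are used; its
commutative product never is. -/
abbrev StdPoly (R : Type) [CommRing R] (n : ℕ) : Type :=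
  MvPolynomial (Fin n) R

/-- The word `x₁^α₁ ⋯ xₙ^αₙ` (variables in increasing order). -/
def stdWord {n : ℕ} (α : Fin n →₀ ℕ) : FreeMonoid (Fin n) :=
  (List.ofFn fun i => FreeMonoid.of i ^ α i).prod

/-- A word, as an element of the free associative algebra. -/
noncomputable def word (R : Type) [CommRing R] {n : ℕ} (w : FreeMonoid (Fin n)) : FreeAlg R n :=
  MonoidAlgebra.of R (FreeMonoid (Fin n)) w

/-- A standard polynomial, as an element of the free associative algebra. -/
noncomputable def stdToFree (R : Type) [CommRing R] (n : ℕ) : StdPoly R n →ₗ[R] FreeAlg R n :=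
  (MvPolynomial.basisMonomials (Fin n) R).constr R fun α => word R (stdWord α)

/-- The data `c i j`, `d i j` of commutation relations `x_j x_i = c_ij x_i x_j + d_ij`, `i < j`.
The entries with `i ≥ j` are never used. -/
structure CommRel (R : Type) [CommRing R] (n : ℕ) where
  c : Fin n → Fin n → R
  d : Fin n → Fin n → StdPoly R n

namespace CommRel

variable {R : Type} [CommRing R] {n : ℕ} (D : CommRel R n)

/-- Apply a ring homomorphism to all coefficients of the commutation relations. -/
noncomputable def map {S : Type} [CommRing S] (φ : R →+* S) : CommRel S n where
  c i j := φ (D.c i j)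
  d i j := MvPolynomial.map φ (D.d i j)

/-- The right hand side `c_ij x_i x_j + d_ij` in the free associative algebra. -/
noncomputable def rhs (i j : Fin n) : FreeAlg R n :=
  D.c i j • word R (FreeMonoid.of i * FreeMonoid.of j) + stdToFree R n (D.d i j)

/-- The commutation relations. -/
inductive Rel : FreeAlg R n → FreeAlg R n → Prop
  | comm (i j : Fin n) (hij : i < j) :
      Rel (word R (FreeMonoid.of j * FreeMonoid.of i)) (D.rhs i j)

/-- The algebra `R⟨x₁, …, xₙ ∣ x_j x_i = c_ij x_i x_j + d_ij, i < j⟩`: the quotient of the free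
associative algebra by the two-sided ideal generated by the relations. -/
abbrev Alg : Type := RingQuot D.Rel

/-- The element `∑ c_α x^α` of the algebra given by a standard polynomial. -/
noncomputable def ofStd : StdPoly R n →ₗ[R] D.Alg :=
  (RingQuot.mkAlgHom R D.Rel).toLinearMap ∘ₗ stdToFree R n

/-- A reduction step with respect to the relations: in `f`, the word `u x_j x_i v` (with `i < j`) is
rewritten as `u (c_ij x_i x_j + d_ij) v`; all other terms of `f` are kept. -/
def Step (f g : FreeAlg R n) : Prop :=
  ∃ (i j : Fin n) (u v : FreeMonoid (Fin n)), i < j ∧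
    g = f - f.coeff (u * (FreeMonoid.of j * FreeMonoid.of i) * v) •
      (word R u * (word R (FreeMonoid.of j * FreeMonoid.of i) - D.rhs i j) * word R v)

/-- `f` reduces to zero with respect to the relations, in finitely many steps. -/
def ReducesToZero (f : FreeAlg R n) : Prop :=
  Relation.ReflTransGen D.Step f 0

/-- `c_ik c_jk d_ij x_k - x_k d_ij + c_jk x_j d_ik - c_ij d_ik x_j + d_jk x_i - c_ij c_ik x_i d_jk`. -/
noncomputable def nondegElem (i j k : Fin n) : FreeAlg R n :=
  let x : Fin n → FreeAlg R n := fun l => word R (FreeMonoid.of l)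
  let d : Fin n → Fin n → FreeAlg R n := fun a b => stdToFree R n (D.d a b)
  (D.c i k * D.c j k) • (d i j * x k) - x k * d i j + D.c j k • (x j * d i k)
    - D.c i j • (d i k * x j) + d j k * x i - (D.c i j * D.c i k) • (x i * d j k)

/-- The monomial ordering `m` is admissible: `d_ij = 0` or `ε_i + ε_j > exp(d_ij)` for `i < j`. -/
def Admissible (m : MonomialOrder (Fin n)) : Prop :=
  ∀ i j : Fin n, i < j → D.d i j = 0 ∨
    m.toSyn (m.degree (D.d i j)) < m.toSyn (Finsupp.single i 1 + Finsupp.single j 1)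

/-- The relations define a `G`-algebra (over a field). -/
structure IsGAlgebra {K : Type} [Field K] (D : CommRel K n) : Prop where
  c_ne_zero : ∀ i j : Fin n, i < j → D.c i j ≠ 0
  exists_admissible : ∃ m : MonomialOrder.{0, 0} (Fin n), D.Admissible m
  nondegenerate : ∀ i j k : Fin n, i < j → j < k → D.ReducesToZero (D.nondegElem i j k)

/-- The unique standard polynomial representing `f` (standard monomials are a basis of a `G`-algebra,
so that `ofStd` is bijective in this case). -/
noncomputable def stdRep (f : D.Alg) : StdPoly R n :=
  Function.invFun D.ofStd f

/-- The leading exponent of `f ≠ 0`. -/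
noncomputable def exp (m : MonomialOrder (Fin n)) (f : D.Alg) : Fin n →₀ ℕ :=
  m.degree (D.stdRep f)

/-- The leading exponents of the nonzero elements of a set `T`. -/
def expSet (m : MonomialOrder (Fin n)) (T : Set D.Alg) : Set (Fin n →₀ ℕ) :=
  {α | ∃ f ∈ T, f ≠ 0 ∧ D.exp m f = α}

/-- `G` is a (left) Gröbner basis for the left ideal `I` (Mathlib's `Ideal` is a left ideal). -/
def IsGroebnerBasisFor (m : MonomialOrder (Fin n)) (G : Finset D.Alg) (I : Ideal D.Alg) : Prop :=
  (∀ g ∈ G, g ∈ I ∧ g ≠ 0) ∧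
    D.expSet m (I : Set D.Alg) = ⋃ g ∈ G, Set.range fun β : Fin n →₀ ℕ => D.exp m g + β

/-- `G` is a left Gröbner basis: one for the left ideal that it generates. -/
def IsLeftGroebnerBasis (m : MonomialOrder (Fin n)) (G : Finset D.Alg) : Prop :=
  D.IsGroebnerBasisFor m G (Ideal.span (G : Set D.Alg))

/-- `G` is the reduced Gröbner basis for `I`: leading coefficients are `1`, and no monomial of an
element of `G` is divisible by the leading monomial of another element. -/
def IsReducedGroebnerBasisFor (m : MonomialOrder (Fin n)) (G : Finset D.Alg)
    (I : Ideal D.Alg) : Prop :=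
  D.IsGroebnerBasisFor m G I ∧ (∀ g ∈ G, m.leadingCoeff (D.stdRep g) = 1) ∧
    ∀ g ∈ G, ∀ h ∈ G, h ≠ g → ∀ α ∈ (D.stdRep g).support, ¬ D.exp m h ≤ α

/-- The relations are `ω`-homogeneous: `|α|_ω = ω_i + ω_j` for every `α` in the Newton diagram of
`d_ij`, `i < j`. -/
def IsGraded (ω : Fin n → ℕ) : Prop :=
  ∀ i j : Fin n, i < j → MvPolynomial.IsWeightedHomogeneous ω (D.d i j) (ω i + ω j)

/-- For relations `C` with integer coefficients: the same relations with coefficients in `R`. For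
`R = ℚ` they define `A`, for `R = ℤ/pℤ` they define `A_p`. -/
noncomputable abbrev baseChange (C : CommRel ℤ n) (R : Type) [CommRing R] : CommRel R n :=
  C.map (Int.castRingHom R)

/-- The left ideal of the algebra with coefficients in `R` that is generated by the elements
`f_1, …, f_r` with integer coefficients. For `R = ℚ` it is the ideal `I` with these generators, for
`R = ℤ/pℤ` it is the ideal generated by their reductions modulo `p`. -/
noncomputable def leftIdeal (C : CommRel ℤ n) (R : Type) [CommRing R] {r : ℕ}
    (f : Fin r → StdPoly ℤ n) : Ideal (C.baseChange R).Alg :=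
  Ideal.span (Set.range fun j => (C.baseChange R).ofStd (MvPolynomial.map (Int.castRingHom R) (f j)))

/-- `N` divides no `c_ij` and no (nonzero) coefficient of any `d_ij`, `i < j`. -/
def DividesNoCoeff (C : CommRel ℤ n) (N : ℕ) : Prop :=
  ∀ i j : Fin n, i < j →
    ¬ (N : ℤ) ∣ C.c i j ∧ ∀ α ∈ (C.d i j).support, ¬ (N : ℤ) ∣ (C.d i j).coeff α

end CommRel

/-! The inclusion I ⊂ ⟨G⟩ gives exp(I) ⊂ exp(⟨G⟩), and the latter equals exp(Ĩ_p), because both are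
unions of cones over the same leading exponents. The core is the reverse inclusion exp(Ĩ_p) ⊂ exp(I)
(`expSet_leftIdeal_subset`). After that, I and ⟨G⟩ are nested left ideals with the same leading
exponents, hence equal (`ideal_le_of_expSet_subset`).

The reverse inclusion is a comparison of Hilbert functions, one ω-degree e at a time. Since ω is
positive, only finitely many exponents have degree e. For each such α in exp(Ĩ_p), an element with
leading exponent α lifts to an integral standard polynomial whose degree-e component lies in I over
ℚ and has leading exponent α modulo p (`exists_homogeneousLift`). These components are linearly
independent over ℤ, by triangularity modulo p and repeated division by p
(`eq_zero_of_sum_smul_eq_zero`). Any nonzero combination lies in I and has its leading exponent over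
ℚ in exp(I), in degree e. So exp(I) has at least as many exponents of degree e as exp(Ĩ_p); being
contained in it, it agrees with it.

Lifting requires standard monomials to be a basis over ℚ and over 𝔽_p compatibly. This is Bergman's
diamond lemma over an arbitrary commutative ring (`TailsLT.ofStd_bijective`), applied to normal
forms computed over ℤ. A rewriting to zero over ℚ of an integral element is already one over ℤ, so
it can be reduced modulo p. -/

/-- The multidegree of a word. -/
noncomputable def wordContent {n : ℕ} (w : FreeMonoid (Fin n)) : Fin n →₀ ℕ :=
  Multiset.toFinsupp (w.toList : Multiset (Fin n))

/-- The sum of the letters of a word, each weighted by the number of letters to its right. -/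
def wordWeight {n : ℕ} (w : FreeMonoid (Fin n)) : ℕ :=
  w.toList.rec 0 fun a l s => a * l.length + s

/-! ### Words, and the order that makes rewriting terminate -/

section Words

variable {n : ℕ}

open FreeMonoid

@[simp] theorem wordContent_mul (u v : FreeMonoid (Fin n)) :
    wordContent (u * v) = wordContent u + wordContent v := by
  simp [wordContent, ← Multiset.coe_add]

@[simp] theorem wordContent_one : wordContent (1 : FreeMonoid (Fin n)) = 0 := by
  simp [wordContent]

@[simp] theorem wordContent_of (i : Fin n) : wordContent (of i) = Finsupp.single i 1 := by
  simp [wordContent, toList_of]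

theorem wordContent_eq_iff {u v : FreeMonoid (Fin n)} :
    wordContent u = wordContent v ↔ u.toList.Perm v.toList := by
  simp [wordContent]

@[simp] theorem wordWeight_one : wordWeight (1 : FreeMonoid (Fin n)) = 0 := rfl

theorem wordWeight_of_mul (i : Fin n) (w : FreeMonoid (Fin n)) :
    wordWeight (of i * w) = i * w.toList.length + wordWeight w := rfl

theorem wordWeight_mul (u v : FreeMonoid (Fin n)) :
    wordWeight (u * v) =
      wordWeight u + (u.toList.map Fin.val).sum * v.toList.length + wordWeight v := by
  induction u using FreeMonoid.inductionOn' with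
  | one => simp
  | of_mul i u ih =>
    rw [mul_assoc, wordWeight_of_mul, wordWeight_of_mul, ih]
    simp [toList_mul, toList_of]
    ring

@[simp] theorem wordWeight_of (i : Fin n) : wordWeight (of i) = 0 := by
  simpa using wordWeight_of_mul i 1

theorem wordWeight_triple (a b c : Fin n) : wordWeight (of a * of b * of c) = 2 * a.val + b := by
  rw [mul_assoc, wordWeight_of_mul, wordWeight_of_mul]
  simp [toList_mul, toList_of]
  ring

/-- The order on words used for termination: first the multidegree, then the weight. -/
noncomputable def wordMeasure (m : MonomialOrder (Fin n)) (w : FreeMonoid (Fin n)) : m.syn ×ₗ ℕ :=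
  toLex (m.toSyn (wordContent w), wordWeight w)

variable {m : MonomialOrder (Fin n)}

theorem wordMeasure_lt_iff {u v : FreeMonoid (Fin n)} : wordMeasure m u < wordMeasure m v ↔
    m.toSyn (wordContent u) < m.toSyn (wordContent v) ∨
      wordContent u = wordContent v ∧ wordWeight u < wordWeight v := by
  simp [wordMeasure, Prod.Lex.toLex_lt_toLex]

theorem wordMeasure_le_of_weight {u v : FreeMonoid (Fin n)} (h : wordContent u = wordContent v)
    (h' : wordWeight u ≤ wordWeight v) : wordMeasure m u ≤ wordMeasure m v := by
  simp [wordMeasure, Prod.Lex.toLex_le_toLex, h, h']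

/-- When the contents of a and b agree, the cross terms in `wordWeight_mul` agree as well, since
they depend only on lengths and letter sums. The weight thus detects a swap x_j x_i → x_i x_j inside
any context. -/
theorem wordMeasure_mul_lt {a b : FreeMonoid (Fin n)} (h : wordMeasure m a < wordMeasure m b)
    (u v : FreeMonoid (Fin n)) : wordMeasure m (u * a * v) < wordMeasure m (u * b * v) := by
  rw [wordMeasure_lt_iff] at h ⊢
  rcases h with h | ⟨h, h'⟩
  · left
    simpa using h
  · right
    refine ⟨by simp [h], ?_⟩
    have hp := wordContent_eq_iff.1 h
    have hl := hp.length_eq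
    have hs := (hp.map Fin.val).sum_eq
    simp only [wordWeight_mul, toList_mul, List.map_append, List.sum_append, hl, hs]
    omega

@[simp] theorem wordContent_stdWord (α : Fin n →₀ ℕ) : wordContent (stdWord α) = α := by
  have hp (i : Fin n) (k : ℕ) : wordContent (of i ^ k) = Finsupp.single i k := by
    induction k with
    | zero => simp
    | succ k ih => simp [pow_succ, ih]
  have hl (l : List (FreeMonoid (Fin n))) : wordContent l.prod = (l.map wordContent).sum := by
    induction l with
    | nil => simp
    | cons a l ih => simp [ih]
  rw [stdWord, hl, List.map_ofFn, List.sum_ofFn]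
  simp only [Function.comp_apply, hp]
  exact (Finsupp.univ_sum_single α)

theorem stdWord_pairwise (α : Fin n →₀ ℕ) : (stdWord α).toList.Pairwise (· ≤ ·) := by
  have hp (i : Fin n) (k : ℕ) : (of i ^ k).toList = List.replicate k i := by
    induction k with
    | zero => simp
    | succ k ih => simp [pow_succ', toList_mul, ih, List.replicate_succ]
  have hl (l : List (FreeMonoid (Fin n))) : l.prod.toList = (l.map toList).flatten := by
    induction l with
    | nil => simp
    | cons a l ih => simp [ih, toList_mul]
  rw [stdWord, hl, List.map_ofFn, List.pairwise_flatten, List.pairwise_ofFn]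
  constructor
  · intro l hl
    obtain ⟨i, rfl⟩ := List.mem_ofFn.1 hl
    simp [hp, List.pairwise_replicate]
  · intro i j hij
    simp only [Function.comp_apply, hp, List.mem_replicate]
    rintro x ⟨-, rfl⟩ y ⟨-, rfl⟩
    exact hij.le

theorem stdWord_ne_of_lt {α : Fin n →₀ ℕ} {i j : Fin n} (hij : i < j) (u v : FreeMonoid (Fin n)) :
    stdWord α ≠ u * (of j * of i) * v := by
  intro h
  have := stdWord_pairwise α
  rw [h] at this
  simp [toList_mul, toList_of, List.pairwise_append] at this
  omega

/-- A word without descents is sorted, and a sorted word is determined by its multiset of letters.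
-/
theorem eq_stdWord_of_forall_ne {w : FreeMonoid (Fin n)}
    (h : ∀ (u v : FreeMonoid (Fin n)) (i j : Fin n), i < j → w ≠ u * (of j * of i) * v) :
    w = stdWord (wordContent w) := by
  have hs : w.toList.Pairwise (· ≤ ·) := by
    rw [← List.isChain_iff_pairwise, List.isChain_iff_forall_rel_of_append_cons_cons]
    intro a b l₁ l₂ hw
    by_contra hab
    refine h (ofList l₁) (ofList l₂) b a (not_le.1 hab) ?_
    apply toList.injective
    simp [hw, toList_mul, toList_of]
  apply toList.injective
  refine List.Perm.eq_of_pairwise (le := (· ≤ ·)) (fun a b _ _ h h' => le_antisymm h h') hs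
    (stdWord_pairwise _) ?_
  rw [← wordContent_eq_iff, wordContent_stdWord]

end Words

/-! ### Linear algebra on the span of words -/

section FreeAlg

variable {R : Type} [CommRing R] {n : ℕ}

theorem word_mul (u v : FreeMonoid (Fin n)) : word R (u * v) = word R u * word R v :=
  map_mul _ _ _

@[simp] theorem word_one : word R (1 : FreeMonoid (Fin n)) = 1 :=
  map_one _

theorem coeff_word (w : FreeMonoid (Fin n)) : (word R w).coeff = Finsupp.single w 1 := rfl

theorem sum_coeff_smul_word (f : FreeAlg R n) : (f.coeff.sum fun w c => c • word R w) = f := by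
  conv_rhs => rw [← MonoidAlgebra.sum_coeff_single f]
  refine Finsupp.sum_congr fun w _ => ?_
  simp [word, MonoidAlgebra.smul_single]

theorem stdToFree_monomial (α : Fin n →₀ ℕ) (c : R) :
    stdToFree R n (MvPolynomial.monomial α c) = c • word R (stdWord α) := by
  have h : MvPolynomial.monomial α c = c • MvPolynomial.basisMonomials (Fin n) R α := by
    simp [MvPolynomial.smul_monomial]
  rw [h, map_smul, stdToFree, Module.Basis.constr_basis]

theorem stdToFree_mem {N : Submodule R (FreeAlg R n)} {P : StdPoly R n}
    (h : ∀ α ∈ P.support, word R (stdWord α) ∈ N) : stdToFree R n P ∈ N := by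
  rw [MvPolynomial.as_sum P, map_sum]
  exact N.sum_mem fun α hα => by
    rw [stdToFree_monomial]
    exact N.smul_mem _ (h α hα)

/-- Linear maps out of the free algebra, given by their values on words. -/
noncomputable def liftWords {M : Type} [AddCommGroup M] [Module R M]
    (g : FreeMonoid (Fin n) → M) : FreeAlg R n →ₗ[R] M where
  toFun f := f.coeff.sum fun w c => c • g w
  map_add' x y := by
    rw [MonoidAlgebra.coeff_add]
    exact Finsupp.sum_add_index' (by simp) (by simp [add_smul])
  map_smul' c x := by
    rw [MonoidAlgebra.coeff_smul, Finsupp.sum_smul_index' (by simp), RingHom.id_apply,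
      Finsupp.smul_sum]
    simp [mul_smul]

theorem liftWords_apply {M : Type} [AddCommGroup M] [Module R M]
    (g : FreeMonoid (Fin n) → M) (f : FreeAlg R n) :
    liftWords g f = f.coeff.sum fun w c => c • g w := rfl

@[simp] theorem liftWords_word {M : Type} [AddCommGroup M] [Module R M]
    (g : FreeMonoid (Fin n) → M) (w : FreeMonoid (Fin n)) : liftWords (R := R) g (word R w) = g w := by
  simp [liftWords_apply, coeff_word]

theorem FreeAlg.linearMap_ext {M : Type} [AddCommGroup M] [Module R M]
    {g h : FreeAlg R n →ₗ[R] M} (H : ∀ w, g (word R w) = h (word R w)) : g = h := by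
  refine LinearMap.ext fun f => ?_
  rw [← sum_coeff_smul_word f]
  simp [Finsupp.sum, H]

theorem mem_span_word_image_iff {S : Set (FreeMonoid (Fin n))} {f : FreeAlg R n} :
    f ∈ Submodule.span R (word R '' S) ↔ ∀ w, f.coeff w ≠ 0 → w ∈ S := by
  constructor
  · intro hf
    induction hf using Submodule.span_induction with
    | mem x hx =>
      obtain ⟨w, hw, rfl⟩ := hx
      intro w' hw'
      by_cases h : w = w'
      · exact h ▸ hw
      · exact absurd (by rw [coeff_word, Finsupp.single_eq_of_ne' h]) hw'
    | zero => simp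
    | add x y _ _ hx hy =>
      intro w hw
      by_cases h : x.coeff w = 0
      · refine hy w fun h' => hw ?_
        simp [MonoidAlgebra.coeff_add, h, h']
      · exact hx w h
    | smul a x _ hx =>
      intro w hw
      refine hx w fun h => hw ?_
      simp [MonoidAlgebra.coeff_smul, h]
  · intro h
    rw [← sum_coeff_smul_word f]
    exact Submodule.sum_mem _ fun w hw =>
      Submodule.smul_mem _ _ (Submodule.subset_span ⟨w, h w (Finsupp.mem_support_iff.1 hw), rfl⟩)

/-- The span of the words whose measure is less than `t`. -/
noncomputable def wordsBelow (R : Type) [CommRing R] {n : ℕ} (m : MonomialOrder (Fin n)) (t : m.syn ×ₗ ℕ) :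
    Submodule R (FreeAlg R n) :=
  Submodule.span R (word R '' {w | wordMeasure m w < t})

variable {m : MonomialOrder (Fin n)}

theorem word_mem_wordsBelow {t : m.syn ×ₗ ℕ} {w : FreeMonoid (Fin n)} (h : wordMeasure m w < t) :
    word R w ∈ wordsBelow R m t :=
  Submodule.subset_span ⟨w, h, rfl⟩

theorem mem_wordsBelow_iff {t : m.syn ×ₗ ℕ} {f : FreeAlg R n} :
    f ∈ wordsBelow R m t ↔ ∀ w, f.coeff w ≠ 0 → wordMeasure m w < t :=
  mem_span_word_image_iff

theorem wordsBelow_mono {s t : m.syn ×ₗ ℕ} (h : s ≤ t) : wordsBelow R m s ≤ wordsBelow R m t :=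
  Submodule.span_mono (Set.image_mono fun _ hw => lt_of_lt_of_le hw h)

theorem map_mem_of_mem_wordsBelow {M : Type} [AddCommGroup M] [Module R M] {t : m.syn ×ₗ ℕ}
    {N : Submodule R M} (L : FreeAlg R n →ₗ[R] M)
    (h : ∀ w, wordMeasure m w < t → L (word R w) ∈ N) {f : FreeAlg R n}
    (hf : f ∈ wordsBelow R m t) : L f ∈ N := by
  have : wordsBelow R m t ≤ N.comap L := by
    rw [wordsBelow, Submodule.span_le]
    rintro _ ⟨w, hw, rfl⟩
    exact h w hw
  exact this hf

theorem mul_mul_mem_wordsBelow {b : FreeMonoid (Fin n)} {f : FreeAlg R n}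
    (hf : f ∈ wordsBelow R m (wordMeasure m b)) (u v : FreeMonoid (Fin n)) :
    word R u * f * word R v ∈ wordsBelow R m (wordMeasure m (u * b * v)) := by
  refine map_mem_of_mem_wordsBelow (LinearMap.mulLeftRight R (word R u, word R v)) ?_ hf
  intro w hw
  rw [LinearMap.mulLeftRight_apply, ← word_mul, ← word_mul]
  exact word_mem_wordsBelow (wordMeasure_mul_lt hw u v)

end FreeAlg

/-! ### Relators below a given word -/

namespace CommRel

variable {R : Type} [CommRing R] {n : ℕ} (D : CommRel R n)

/-- The element `x_j x_i - c_ij x_i x_j - d_ij`. -/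
noncomputable def relator (i j : Fin n) : FreeAlg R n :=
  word R (FreeMonoid.of j * FreeMonoid.of i) - D.rhs i j

/-- The span of the multiples `u (x_j x_i - c_ij x_i x_j - d_ij) v` of the relators such that the
word `u x_j x_i v` has measure less than `t`. -/
noncomputable def relatorsBelow (m : MonomialOrder (Fin n)) (t : m.syn ×ₗ ℕ) : Submodule R (FreeAlg R n) :=
  Submodule.span R {x | ∃ (i j : Fin n) (u v : FreeMonoid (Fin n)), i < j ∧
    wordMeasure m (u * (FreeMonoid.of j * FreeMonoid.of i) * v) < t ∧
    x = word R u * D.relator i j * word R v}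

/-- All exponents of `d_ij` are smaller than `ε_i + ε_j`. -/
def TailsLT (m : MonomialOrder (Fin n)) : Prop :=
  ∀ i j : Fin n, i < j → ∀ α ∈ (D.d i j).support,
    m.toSyn α < m.toSyn (Finsupp.single i 1 + Finsupp.single j 1)

variable {D} {m : MonomialOrder (Fin n)}

theorem mul_relator_mul_mem {t : m.syn ×ₗ ℕ} {i j : Fin n} (hij : i < j)
    {u v : FreeMonoid (Fin n)}
    (h : wordMeasure m (u * (FreeMonoid.of j * FreeMonoid.of i) * v) < t) :
    word R u * D.relator i j * word R v ∈ D.relatorsBelow m t :=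
  Submodule.subset_span ⟨i, j, u, v, hij, h, rfl⟩

theorem mul_mul_mem_relatorsBelow {b : FreeMonoid (Fin n)} {f : FreeAlg R n}
    (hf : f ∈ D.relatorsBelow m (wordMeasure m b)) (u v : FreeMonoid (Fin n)) :
    word R u * f * word R v ∈ D.relatorsBelow m (wordMeasure m (u * b * v)) := by
  have : D.relatorsBelow m (wordMeasure m b) ≤ (D.relatorsBelow m (wordMeasure m (u * b * v))).comap
      (LinearMap.mulLeftRight R (word R u, word R v)) := by
    conv_lhs => rw [relatorsBelow]
    rw [Submodule.span_le]
    rintro _ ⟨i, j, u', v', hij, h, rfl⟩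
    have h' := wordMeasure_mul_lt h u v
    simp only [SetLike.mem_coe, Submodule.mem_comap, LinearMap.mulLeftRight_apply]
    have := mul_relator_mul_mem (D := D) (t := wordMeasure m (u * b * v)) hij (u := u * u')
      (v := v' * v) (by simpa only [mul_assoc] using h')
    simpa only [word_mul, mul_assoc] using this
  exact this hf

theorem TailsLT.stdToFree_mem_wordsBelow (hD : D.TailsLT m) {i j : Fin n} (hij : i < j) :
    stdToFree R n (D.d i j) ∈ wordsBelow R m (wordMeasure m (FreeMonoid.of j * FreeMonoid.of i)) :=
  stdToFree_mem fun α hα => word_mem_wordsBelow <| wordMeasure_lt_iff.2 <| Or.inl <| by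
    simpa [add_comm] using hD i j hij α hα

theorem TailsLT.rhs_mem_wordsBelow (hD : D.TailsLT m) {i j : Fin n} (hij : i < j) :
    D.rhs i j ∈ wordsBelow R m (wordMeasure m (FreeMonoid.of j * FreeMonoid.of i)) := by
  refine Submodule.add_mem _ (Submodule.smul_mem _ _ (word_mem_wordsBelow ?_))
    (hD.stdToFree_mem_wordsBelow hij)
  refine wordMeasure_lt_iff.2 (Or.inr ⟨by simp [add_comm], ?_⟩)
  simpa [wordWeight_mul, FreeMonoid.toList_of] using hij

/-- Each step subtracts a multiple of a relator whose leading word occurs in the current element,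
and only introduces smaller words. The bound t therefore persists, and f is the sum of what was
subtracted. -/
theorem TailsLT.mem_relatorsBelow_of_reducesToZero (hD : D.TailsLT m) {t : m.syn ×ₗ ℕ} {f : FreeAlg R n}
    (hf : f ∈ wordsBelow R m t) (h : D.ReducesToZero f) : f ∈ D.relatorsBelow m t := by
  induction h using Relation.ReflTransGen.head_induction_on with
  | refl => exact Submodule.zero_mem _
  | @head a b hs _ ih =>
    obtain ⟨i, j, u, v, hij, rfl⟩ := hs
    change a - _ • (word R u * D.relator i j * word R v) ∈ _ → _ at ih
    -- A step at a word with coefficient 0 changes nothing; such a word need not lie below t, so it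
    -- is set aside.
    by_cases hc : a.coeff (u * (FreeMonoid.of j * FreeMonoid.of i) * v) = 0
    · simp only [hc, zero_smul, sub_zero] at ih
      exact ih hf
    have ht := mem_wordsBelow_iff.1 hf _ hc
    have h1 : word R u * D.relator i j * word R v ∈ wordsBelow R m t := by
      rw [relator, mul_sub, sub_mul]
      refine Submodule.sub_mem _ ?_
        (wordsBelow_mono ht.le (mul_mul_mem_wordsBelow (hD.rhs_mem_wordsBelow hij) u v))
      rw [← word_mul, ← word_mul]
      exact word_mem_wordsBelow ht
    have h2 := ih (Submodule.sub_mem _ hf (Submodule.smul_mem _ _ h1))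
    rw [← Submodule.sub_mem_iff_left _
      (Submodule.smul_mem _ _ (mul_relator_mul_mem (D := D) hij ht))]
    exact h2

theorem TailsLT.nondegElem_mem_wordsBelow (hD : D.TailsLT m) {i j k : Fin n} (hij : i < j)
    (hjk : j < k) : D.nondegElem i j k ∈ wordsBelow R m
      (wordMeasure m (FreeMonoid.of k * FreeMonoid.of j * FreeMonoid.of i)) := by
  have hl {a b : Fin n} (hab : a < b) (c : Fin n)
      (hw : wordMeasure m (FreeMonoid.of c * FreeMonoid.of b * FreeMonoid.of a) ≤
        wordMeasure m (FreeMonoid.of k * FreeMonoid.of j * FreeMonoid.of i)) :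
      word R (FreeMonoid.of c) * stdToFree R n (D.d a b) ∈ wordsBelow R m
        (wordMeasure m (FreeMonoid.of k * FreeMonoid.of j * FreeMonoid.of i)) := by
    have := mul_mul_mem_wordsBelow (hD.stdToFree_mem_wordsBelow hab) (FreeMonoid.of c) 1
    rw [word_one, mul_one, mul_one, ← mul_assoc] at this
    exact wordsBelow_mono hw this
  have hr {a b : Fin n} (hab : a < b) (c : Fin n)
      (hw : wordMeasure m (FreeMonoid.of b * FreeMonoid.of a * FreeMonoid.of c) ≤
        wordMeasure m (FreeMonoid.of k * FreeMonoid.of j * FreeMonoid.of i)) :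
      stdToFree R n (D.d a b) * word R (FreeMonoid.of c) ∈ wordsBelow R m
        (wordMeasure m (FreeMonoid.of k * FreeMonoid.of j * FreeMonoid.of i)) := by
    have := mul_mul_mem_wordsBelow (hD.stdToFree_mem_wordsBelow hab) 1 (FreeMonoid.of c)
    rw [word_one, one_mul, one_mul] at this
    exact wordsBelow_mono hw this
  have hij' : i.val < j := hij
  have hjk' : j.val < k := hjk
  have hik := hij.trans hjk
  have hm {a b c : Fin n} (h : wordContent (FreeMonoid.of a * FreeMonoid.of b * FreeMonoid.of c) =
        wordContent (FreeMonoid.of k * FreeMonoid.of j * FreeMonoid.of i))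
      (hw : 2 * a.val + b ≤ 2 * k.val + j) :
      wordMeasure m (FreeMonoid.of a * FreeMonoid.of b * FreeMonoid.of c) ≤
        wordMeasure m (FreeMonoid.of k * FreeMonoid.of j * FreeMonoid.of i) :=
    wordMeasure_le_of_weight h (by simpa only [wordWeight_triple] using hw)
  unfold nondegElem
  refine Submodule.sub_mem _ (Submodule.add_mem _ (Submodule.sub_mem _ (Submodule.add_mem _
    (Submodule.sub_mem _ (Submodule.smul_mem _ _ ?_) ?_) (Submodule.smul_mem _ _ ?_))
    (Submodule.smul_mem _ _ ?_)) ?_) (Submodule.smul_mem _ _ ?_)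
  · exact hr hij _ (hm (by simp only [wordContent_mul]; abel) (by omega))
  · exact hl hij _ le_rfl
  · exact hl hik _ (hm (by simp only [wordContent_mul]; abel) (by omega))
  · exact hr hik _ (hm (by simp only [wordContent_mul]; abel) (by omega))
  · exact hr hjk _ le_rfl
  · exact hl hjk _ (hm (by simp only [wordContent_mul]; abel) (by omega))

end CommRel

/-! ### The diamond lemma: standard monomials form a basis -/

namespace CommRel

variable {R : Type} [CommRing R] {n : ℕ} {D : CommRel R n} {m : MonomialOrder (Fin n)}

/-- All the elements whose vanishing expresses that the overlaps `x_k x_j x_i` resolve reduce to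
zero. -/
def OverlapsResolve (D : CommRel R n) : Prop :=
  ∀ i j k : Fin n, i < j → j < k → D.ReducesToZero (D.nondegElem i j k)

theorem mul_relator_mul_mem_of_left {b : FreeMonoid (Fin n)} {f : FreeAlg R n}
    (hf : f ∈ wordsBelow R m (wordMeasure m b)) {i j : Fin n} (hij : i < j)
    (u s v : FreeMonoid (Fin n)) :
    word R u * f * (word R s * D.relator i j * word R v) ∈ D.relatorsBelow m
      (wordMeasure m (u * b * (s * (FreeMonoid.of j * FreeMonoid.of i) * v))) := by
  refine map_mem_of_mem_wordsBelow
    (LinearMap.mulLeftRight R (word R u, word R s * D.relator i j * word R v)) (fun w hw => ?_) hf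
  have := mul_relator_mul_mem (D := D) hij (u := u * w * s) (v := v)
    (by simpa only [mul_assoc] using
      wordMeasure_mul_lt hw u (s * (FreeMonoid.of j * FreeMonoid.of i) * v))
  simpa only [LinearMap.mulLeftRight_apply, word_mul, mul_assoc] using this

theorem mul_relator_mul_mem_of_right {b : FreeMonoid (Fin n)} {f : FreeAlg R n}
    (hf : f ∈ wordsBelow R m (wordMeasure m b)) {i j : Fin n} (hij : i < j)
    (u s v : FreeMonoid (Fin n)) :
    word R u * D.relator i j * word R s * f * word R v ∈ D.relatorsBelow m
      (wordMeasure m (u * (FreeMonoid.of j * FreeMonoid.of i) * s * b * v)) := by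
  refine map_mem_of_mem_wordsBelow
    (LinearMap.mulLeftRight R (word R u * D.relator i j * word R s, word R v)) (fun w hw => ?_) hf
  have := mul_relator_mul_mem (D := D) hij (u := u) (v := s * w * v)
    (by simpa only [mul_assoc] using
      wordMeasure_mul_lt hw (u * (FreeMonoid.of j * FreeMonoid.of i) * s) v)
  simpa only [LinearMap.mulLeftRight_apply, word_mul, mul_assoc] using this

/-- Sorting both rewritings of x_k x_j x_i further leads to the same multiple of x_i x_j x_k, which
cancels. The nondegeneracy element is what remains, up to relators at four words that are
permutations of x_k x_j x_i of smaller weight. -/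
theorem overlap_identity (i j k : Fin n) :
    D.rhs j k * word R (FreeMonoid.of i) - word R (FreeMonoid.of k) * D.rhs i j =
      D.nondegElem i j k
        + D.c j k • (word R (FreeMonoid.of j) * D.relator i k)
        + (D.c j k * D.c i k) • (D.relator i j * word R (FreeMonoid.of k))
        - D.c i j • (D.relator i k * word R (FreeMonoid.of j))
        - (D.c i j * D.c i k) • (word R (FreeMonoid.of i) * D.relator j k) := by
  simp only [nondegElem, relator, rhs, word_mul, mul_add, add_mul, mul_sub, sub_mul, smul_mul_assoc,
    mul_smul_comm, mul_assoc]
  module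

theorem TailsLT.overlap_mem (hD : D.TailsLT m) (hO : D.OverlapsResolve) {i j k : Fin n}
    (hij : i < j) (hjk : j < k) :
    D.rhs j k * word R (FreeMonoid.of i) - word R (FreeMonoid.of k) * D.rhs i j ∈
      D.relatorsBelow m (wordMeasure m (FreeMonoid.of k * FreeMonoid.of j * FreeMonoid.of i)) := by
  have hij' : i.val < j := hij
  have hjk' : j.val < k := hjk
  have hik := hij.trans hjk
  have hm {a b c : Fin n} (h : wordContent (FreeMonoid.of a * FreeMonoid.of b * FreeMonoid.of c) =
        wordContent (FreeMonoid.of k * FreeMonoid.of j * FreeMonoid.of i))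
      (hw : 2 * a.val + b < 2 * k.val + j) :
      wordMeasure m (FreeMonoid.of a * FreeMonoid.of b * FreeMonoid.of c) <
        wordMeasure m (FreeMonoid.of k * FreeMonoid.of j * FreeMonoid.of i) :=
    wordMeasure_lt_iff.2 (Or.inr ⟨h, by simpa only [wordWeight_triple] using hw⟩)
  have hl {a b : Fin n} (hab : a < b) (c : Fin n)
      (hw : wordMeasure m (FreeMonoid.of c * FreeMonoid.of b * FreeMonoid.of a) <
        wordMeasure m (FreeMonoid.of k * FreeMonoid.of j * FreeMonoid.of i)) :
      word R (FreeMonoid.of c) * D.relator a b ∈ D.relatorsBelow m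
        (wordMeasure m (FreeMonoid.of k * FreeMonoid.of j * FreeMonoid.of i)) := by
    simpa using mul_relator_mul_mem (D := D) hab (u := FreeMonoid.of c) (v := 1)
      (by simpa only [mul_one, mul_assoc] using hw)
  have hr {a b : Fin n} (hab : a < b) (c : Fin n)
      (hw : wordMeasure m (FreeMonoid.of b * FreeMonoid.of a * FreeMonoid.of c) <
        wordMeasure m (FreeMonoid.of k * FreeMonoid.of j * FreeMonoid.of i)) :
      D.relator a b * word R (FreeMonoid.of c) ∈ D.relatorsBelow m
        (wordMeasure m (FreeMonoid.of k * FreeMonoid.of j * FreeMonoid.of i)) := by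
    simpa using mul_relator_mul_mem (D := D) hab (u := 1) (v := FreeMonoid.of c)
      (by simpa only [one_mul] using hw)
  rw [overlap_identity]
  refine Submodule.sub_mem _ (Submodule.sub_mem _ (Submodule.add_mem _ (Submodule.add_mem _
    (hD.mem_relatorsBelow_of_reducesToZero (hD.nondegElem_mem_wordsBelow hij hjk)
      (hO i j k hij hjk))
    (Submodule.smul_mem _ _ ?_)) (Submodule.smul_mem _ _ ?_)) (Submodule.smul_mem _ _ ?_))
    (Submodule.smul_mem _ _ ?_)
  · exact hl hik _ (hm (by simp only [wordContent_mul]; abel) (by omega))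
  · exact hr hij _ (hm (by simp only [wordContent_mul]; abel) (by omega))
  · exact hr hik _ (hm (by simp only [wordContent_mul]; abel) (by omega))
  · exact hl hjk _ (hm (by simp only [wordContent_mul]; abel) (by omega))

theorem TailsLT.sub_mem_of_eq_mul (hD : D.TailsLT m) (hO : D.OverlapsResolve) {i j k l : Fin n}
    (hij : i < j) (hkl : k < l) (u a v v' : FreeMonoid (Fin n))
    (h : FreeMonoid.of j * FreeMonoid.of i * v = a * (FreeMonoid.of l * FreeMonoid.of k) * v') :
    word R u * D.rhs i j * word R v - word R (u * a) * D.rhs k l * word R v' ∈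
      D.relatorsBelow m (wordMeasure m (u * (FreeMonoid.of j * FreeMonoid.of i) * v)) := by
  have h' := congrArg FreeMonoid.toList h
  obtain ⟨la, rfl⟩ := FreeMonoid.ofList.surjective a
  simp only [FreeMonoid.toList_mul, FreeMonoid.toList_of, FreeMonoid.toList_ofList,
    List.append_assoc, List.cons_append, List.nil_append] at h'
  -- The length of the offset decides: 0 means the same factor, 1 an overlap in one letter, and at
  -- least 2 disjoint factors.
  rcases la with _ | ⟨x, _ | ⟨y, s⟩⟩
  · simp only [List.nil_append, List.cons.injEq] at h'
    obtain ⟨rfl, rfl, h'⟩ := h'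
    obtain rfl := FreeMonoid.toList.injective h'
    simp
  · simp only [List.cons_append, List.nil_append, List.cons.injEq] at h'
    obtain ⟨rfl, rfl, h'⟩ := h'
    obtain rfl : v = FreeMonoid.of k * v' := FreeMonoid.toList.injective h'
    have := mul_mul_mem_relatorsBelow (hD.overlap_mem hO hkl hij) u v'
    rw [mul_sub, sub_mul] at this
    simpa only [FreeMonoid.ofList_singleton, word_mul, mul_assoc] using this
  · simp only [List.cons_append, List.cons.injEq] at h'
    obtain ⟨rfl, rfl, h'⟩ := h'
    obtain rfl : v = FreeMonoid.ofList s * (FreeMonoid.of l * FreeMonoid.of k) * v' :=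
      FreeMonoid.toList.injective (by simp [FreeMonoid.toList_mul, FreeMonoid.toList_of, h'])
    -- For disjoint factors, subtract (relator)·s·(right side) from (right side)·s·(relator): the
    -- terms with both factors rewritten cancel, leaving the required difference.
    have h1 := mul_relator_mul_mem_of_left (D := D) (hD.rhs_mem_wordsBelow hij) hkl u
      (FreeMonoid.ofList s) v'
    have h2 := mul_relator_mul_mem_of_right (D := D) (hD.rhs_mem_wordsBelow hkl) hij u
      (FreeMonoid.ofList s) v'
    have h3 := Submodule.sub_mem _ h1 (by simpa only [mul_assoc] using h2)
    convert h3 using 1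
    · simp only [relator, FreeMonoid.ofList_cons, word_mul, mul_sub, sub_mul, mul_assoc]
      abel

theorem TailsLT.sub_mem_of_eq (hD : D.TailsLT m) (hO : D.OverlapsResolve) {i j k l : Fin n}
    (hij : i < j) (hkl : k < l) {u v u' v' : FreeMonoid (Fin n)}
    (h : u * (FreeMonoid.of j * FreeMonoid.of i) * v =
      u' * (FreeMonoid.of l * FreeMonoid.of k) * v') :
    word R u * D.rhs i j * word R v - word R u' * D.rhs k l * word R v' ∈
      D.relatorsBelow m (wordMeasure m (u * (FreeMonoid.of j * FreeMonoid.of i) * v)) := by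
  have h' := congrArg FreeMonoid.toList h
  rw [mul_assoc u, mul_assoc u', FreeMonoid.toList_mul u, FreeMonoid.toList_mul u',
    List.append_eq_append_iff] at h'
  rcases h' with ⟨a, h1, h2⟩ | ⟨a, h1, h2⟩
  · obtain rfl : u' = u * FreeMonoid.ofList a := FreeMonoid.toList.injective h1
    exact hD.sub_mem_of_eq_mul hO hij hkl u _ v v' (by
      rw [mul_assoc (FreeMonoid.ofList a)]
      exact FreeMonoid.toList.injective h2)
  · obtain rfl : u = u' * FreeMonoid.ofList a := FreeMonoid.toList.injective h1
    have := hD.sub_mem_of_eq_mul hO hkl hij u' (FreeMonoid.ofList a) v' v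
      (by rw [mul_assoc (FreeMonoid.ofList a)]; exact FreeMonoid.toList.injective h2)
    rw [h, ← neg_sub]
    exact Submodule.neg_mem _ this

/-- A word is reducible if it contains a factor `x_j x_i` with `i < j`. -/
def Reducible (w : FreeMonoid (Fin n)) : Prop :=
  ∃ x : FreeMonoid (Fin n) × FreeMonoid (Fin n) × Fin n × Fin n, x.2.2.1 < x.2.2.2 ∧
    w = x.1 * (FreeMonoid.of x.2.2.2 * FreeMonoid.of x.2.2.1) * x.2.1

/-- A reducible word after one step of the rewriting. -/
noncomputable def rewriteOnce (D : CommRel R n) {w : FreeMonoid (Fin n)} (h : Reducible w) :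
    FreeAlg R n :=
  word R h.choose.1 * D.rhs h.choose.2.2.1 h.choose.2.2.2 * word R h.choose.2.1

theorem TailsLT.rewriteOnce_mem (hD : D.TailsLT m) {w : FreeMonoid (Fin n)} (h : Reducible w) :
    D.rewriteOnce h ∈ wordsBelow R m (wordMeasure m w) := by
  have := mul_mul_mem_wordsBelow (hD.rhs_mem_wordsBelow h.choose_spec.1) h.choose.1 h.choose.2.1
  rwa [← h.choose_spec.2] at this

theorem wordMeasure_wf (m : MonomialOrder (Fin n)) :
    WellFounded (InvImage (· < ·) (wordMeasure m)) :=
  InvImage.wf _ wellFounded_lt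

open Classical in
/-- The normal form of a word with respect to the rewriting rules. -/
noncomputable def normalWord (D : CommRel R n) (m : MonomialOrder (Fin n)) :
    FreeMonoid (Fin n) → StdPoly R n :=
  (wordMeasure_wf m).fix fun w ih =>
    if h : Reducible w then
      -- The default 0 is never reached on words occurring in `rewriteOnce` when the tails are
      -- small, by `TailsLT.rewriteOnce_mem`.
      liftWords (fun w' => if h' : wordMeasure m w' < wordMeasure m w then ih w' h' else 0)
        (D.rewriteOnce h)
    else MvPolynomial.monomial (wordContent w) 1

/-- The normal form of an element of the free algebra. -/
noncomputable def normalForm (D : CommRel R n) (m : MonomialOrder (Fin n)) :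
    FreeAlg R n →ₗ[R] StdPoly R n :=
  liftWords (D.normalWord m)

theorem normalForm_word_of_not_reducible {w : FreeMonoid (Fin n)} (h : ¬ Reducible w) :
    D.normalForm m (word R w) = MvPolynomial.monomial (wordContent w) 1 := by
  rw [normalForm, liftWords_word, normalWord, WellFounded.fix_eq, dif_neg h]

theorem TailsLT.normalForm_word (hD : D.TailsLT m) {w : FreeMonoid (Fin n)} (h : Reducible w) :
    D.normalForm m (word R w) = D.normalForm m (D.rewriteOnce h) := by
  rw [normalForm, liftWords_word, normalWord, WellFounded.fix_eq, dif_pos h, liftWords_apply,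
    liftWords_apply]
  refine Finsupp.sum_congr fun w' hw' => ?_
  rw [dif_pos (mem_wordsBelow_iff.1 (hD.rewriteOnce_mem h) w' (Finsupp.mem_support_iff.1 hw'))]

/-- Well-founded induction on the word u x_j x_i v. The given rewriting and the one chosen in
`normalWord` differ by relators at smaller words, which the normal form already kills. -/
theorem TailsLT.normalForm_mul_relator_mul (hD : D.TailsLT m) (hO : D.OverlapsResolve)
    {i j : Fin n} (hij : i < j) (u v : FreeMonoid (Fin n)) :
    D.normalForm m (word R u * D.relator i j * word R v) = 0 := by
  generalize hw : u * (FreeMonoid.of j * FreeMonoid.of i) * v = w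
  induction w using (wordMeasure_wf m).induction generalizing i j u v with
  | _ w ih =>
    have hlow : D.relatorsBelow m (wordMeasure m w) ≤ LinearMap.ker (D.normalForm m) := by
      rw [relatorsBelow, Submodule.span_le]
      rintro _ ⟨i', j', u', v', hij', h, rfl⟩
      exact ih _ h hij' u' v' rfl
    have hr : Reducible w := ⟨⟨u, v, i, j⟩, hij, hw.symm⟩
    have h1 := hD.normalForm_word hr
    have h2 := hD.sub_mem_of_eq hO hij hr.choose_spec.1 (hw.trans hr.choose_spec.2)
    rw [hw] at h2
    have h3 := hlow h2
    rw [LinearMap.mem_ker, map_sub, sub_eq_zero] at h3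
    rw [relator, mul_sub, sub_mul, map_sub, ← word_mul, ← word_mul, hw, h1, h3, sub_eq_zero]
    rfl

theorem normalForm_stdToFree (P : StdPoly R n) : D.normalForm m (stdToFree R n P) = P := by
  conv_rhs => rw [MvPolynomial.as_sum P]
  conv_lhs => rw [MvPolynomial.as_sum P]
  rw [map_sum, map_sum]
  refine Finset.sum_congr rfl fun α _ => ?_
  rw [stdToFree_monomial, map_smul, normalForm_word_of_not_reducible, wordContent_stdWord,
    MvPolynomial.smul_monomial, smul_eq_mul, mul_one]
  rintro ⟨x, hx, h⟩
  exact stdWord_ne_of_lt hx _ _ h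

/-- The quotient map from the free algebra. -/
noncomputable def toAlg (D : CommRel R n) : FreeAlg R n →ₐ[R] D.Alg := RingQuot.mkAlgHom R D.Rel

theorem ofStd_apply (P : StdPoly R n) : D.ofStd P = D.toAlg (stdToFree R n P) := rfl

theorem toAlg_surjective : Function.Surjective D.toAlg := RingQuot.mkAlgHom_surjective R D.Rel

theorem toAlg_relator {i j : Fin n} (hij : i < j) : D.toAlg (D.relator i j) = 0 := by
  rw [relator, map_sub, sub_eq_zero]
  exact RingQuot.mkAlgHom_rel R (Rel.comm i j hij)

theorem TailsLT.normalForm_eq_of_toAlg_eq (hD : D.TailsLT m) (hO : D.OverlapsResolve)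
    {x y : FreeAlg R n} (h : D.toAlg x = D.toAlg y) : D.normalForm m x = D.normalForm m y := by
  -- Two-sided multipliers are carried along so that the closure of the relation under products is
  -- absorbed into u and v.
  have key {a b : FreeAlg R n} (hab : RingQuot.Rel D.Rel a b) (u v : FreeAlg R n) :
      D.normalForm m (u * a * v) = D.normalForm m (u * b * v) := by
    induction hab generalizing u v with
    | of h =>
      obtain ⟨i, j, hij⟩ := h
      rw [← sub_eq_zero, ← map_sub, ← sub_mul, ← mul_sub]
      change D.normalForm m (u * D.relator i j * v) = 0
      have h1 : (D.normalForm m) ∘ₗ LinearMap.mulRight R v ∘ₗ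
          LinearMap.mulRight R (D.relator i j) = 0 := by
        refine FreeAlg.linearMap_ext fun w => ?_
        have h2 : (D.normalForm m) ∘ₗ LinearMap.mulLeft R (word R w * D.relator i j) = 0 :=
          FreeAlg.linearMap_ext fun w' => hD.normalForm_mul_relator_mul hO hij w w'
        exact LinearMap.congr_fun h2 v
      exact LinearMap.congr_fun h1 u
    | add_left _ ih => simp only [mul_add, add_mul, map_add, ih]
    | mul_left _ ih => simpa only [mul_assoc] using ih u (_ * v)
    | mul_right _ ih => simpa only [mul_assoc] using ih (u * _) v
  have h' : Relation.EqvGen (RingQuot.Rel D.Rel) x y := by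
    simp only [toAlg, RingQuot.mkAlgHom_def, RingQuot.mkRingHom_def] at h
    exact Quot.eqvGen_exact (congrArg RingQuot.toQuot h)
  clear h
  induction h' with
  | rel a b hab => simpa using key hab 1 1
  | refl => rfl
  | symm _ _ _ ih => exact ih.symm
  | trans _ _ _ _ _ ih1 ih2 => exact ih1.trans ih2

theorem TailsLT.toAlg_normalForm (hD : D.TailsLT m) (x : FreeAlg R n) :
    D.ofStd (D.normalForm m x) = D.toAlg x := by
  suffices h : D.ofStd ∘ₗ D.normalForm m = D.toAlg.toLinearMap from LinearMap.congr_fun h x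
  refine FreeAlg.linearMap_ext fun w => ?_
  induction w using (wordMeasure_wf m).induction with
  | _ w ih =>
    rw [LinearMap.comp_apply, AlgHom.toLinearMap_apply]
    by_cases h : Reducible w
    · have h1 : wordsBelow R m (wordMeasure m w) ≤
          LinearMap.ker (D.ofStd ∘ₗ D.normalForm m - D.toAlg.toLinearMap) := by
        rw [wordsBelow, Submodule.span_le]
        rintro _ ⟨w', hw', rfl⟩
        simpa [sub_eq_zero] using ih w' hw'
      have h2 := h1 (hD.rewriteOnce_mem h)
      rw [LinearMap.mem_ker, LinearMap.sub_apply, sub_eq_zero, LinearMap.comp_apply,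
        AlgHom.toLinearMap_apply] at h2
      rw [hD.normalForm_word h, h2]
      have h3 := toAlg_relator (D := D) h.choose_spec.1
      rw [relator, map_sub, sub_eq_zero] at h3
      conv_rhs => rw [h.choose_spec.2]
      rw [rewriteOnce, map_mul, map_mul, ← h3, word_mul _ h.choose.2.1, word_mul h.choose.1, map_mul,
        map_mul]
    · rw [normalForm_word_of_not_reducible h, ofStd_apply, stdToFree_monomial, one_smul,
        ← eq_stdWord_of_forall_ne]
      rintro u v i j hij rfl
      exact h ⟨⟨u, v, i, j⟩, hij, rfl⟩

theorem TailsLT.ofStd_bijective (hD : D.TailsLT m) (hO : D.OverlapsResolve) :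
    Function.Bijective D.ofStd := by
  constructor
  · intro P Q h
    simpa only [normalForm_stdToFree] using hD.normalForm_eq_of_toAlg_eq hO h
  · intro a
    obtain ⟨x, rfl⟩ := toAlg_surjective a
    exact ⟨_, hD.toAlg_normalForm x⟩

/-! ### Rewriting respects the ω-grading -/

/-- The `ω`-weight of a word. -/
noncomputable def wordDegree (ω : Fin n → ℕ) (w : FreeMonoid (Fin n)) : ℕ :=
  Finsupp.weight ω (wordContent w)

theorem wordDegree_mul (ω : Fin n → ℕ) (u v : FreeMonoid (Fin n)) :
    wordDegree ω (u * v) = wordDegree ω u + wordDegree ω v := by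
  simp [wordDegree]

/-- The span of the words of `ω`-weight `e`. -/
noncomputable def wordsOfDegree (R : Type) [CommRing R] {n : ℕ} (ω : Fin n → ℕ) (e : ℕ) :
    Submodule R (FreeAlg R n) :=
  Submodule.span R (word R '' {w | wordDegree ω w = e})

theorem word_mul_mul_mem_wordsOfDegree {ω : Fin n → ℕ} {e : ℕ} {f : FreeAlg R n}
    (hf : f ∈ wordsOfDegree R ω e) (u v : FreeMonoid (Fin n)) :
    word R u * f * word R v ∈ wordsOfDegree R ω (wordDegree ω u + e + wordDegree ω v) := by
  have : wordsOfDegree R ω e ≤ (wordsOfDegree R ω (wordDegree ω u + e + wordDegree ω v)).comap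
      (LinearMap.mulLeftRight R (word R u, word R v)) := by
    conv_lhs => rw [wordsOfDegree]
    rw [Submodule.span_le]
    rintro _ ⟨w, rfl, rfl⟩
    refine Submodule.subset_span ⟨u * w * v, by simp [wordDegree_mul], ?_⟩
    rw [word_mul, word_mul, LinearMap.mulLeftRight_apply]
  exact this hf

theorem stdToFree_mem_wordsOfDegree {ω : Fin n → ℕ} {e : ℕ} {P : StdPoly R n}
    (hP : MvPolynomial.IsWeightedHomogeneous ω P e) :
    stdToFree R n P ∈ wordsOfDegree R ω e :=
  stdToFree_mem fun α hα => Submodule.subset_span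
    ⟨_, by simpa [wordDegree] using hP (MvPolynomial.mem_support_iff.1 hα), rfl⟩

theorem IsGraded.rhs_mem {ω : Fin n → ℕ} (hω : D.IsGraded ω) {i j : Fin n} (hij : i < j) :
    D.rhs i j ∈ wordsOfDegree R ω (ω i + ω j) := by
  refine Submodule.add_mem _ (Submodule.smul_mem _ _ (Submodule.subset_span ⟨_, ?_, rfl⟩))
    (stdToFree_mem_wordsOfDegree (hω i j hij))
  simp [wordDegree, Finsupp.weight_single]

theorem TailsLT.isWeightedHomogeneous_normalForm (hD : D.TailsLT m) {ω : Fin n → ℕ}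
    (hω : D.IsGraded ω) {e : ℕ} {x : FreeAlg R n} (hx : x ∈ wordsOfDegree R ω e) :
    MvPolynomial.IsWeightedHomogeneous ω (D.normalForm m x) e := by
  have key (w : FreeMonoid (Fin n)) :
      D.normalForm m (word R w) ∈ MvPolynomial.weightedHomogeneousSubmodule R ω (wordDegree ω w) := by
    induction w using (wordMeasure_wf m).induction with
    | _ w ih =>
      by_cases h : Reducible w
      · rw [hD.normalForm_word h]
        have h1 := hD.rewriteOnce_mem h
        have h2 : D.rewriteOnce h ∈ wordsOfDegree R ω (wordDegree ω w) := by
          have := word_mul_mul_mem_wordsOfDegree (hω.rhs_mem h.choose_spec.1) h.choose.1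
            h.choose.2.1
          have e1 : wordDegree ω w = _ := congrArg (wordDegree ω) h.choose_spec.2
          rw [e1, rewriteOnce]
          simpa [wordDegree_mul, wordDegree, Finsupp.weight_single, add_comm (ω h.choose.2.2.1)]
            using this
        rw [mem_wordsBelow_iff] at h1
        rw [wordsOfDegree, mem_span_word_image_iff] at h2
        rw [normalForm, liftWords_apply]
        refine Submodule.sum_mem _ fun w' hw' => Submodule.smul_mem _ _ ?_
        have hw'' := Finsupp.mem_support_iff.1 hw'
        have h3 := ih w' (h1 w' hw'')
        rwa [normalForm, liftWords_word, h2 w' hw''] at h3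
      · rw [normalForm_word_of_not_reducible h]
        exact MvPolynomial.isWeightedHomogeneous_monomial _ _ _ rfl
  have : wordsOfDegree R ω e ≤
      (MvPolynomial.weightedHomogeneousSubmodule R ω e).comap (D.normalForm m) := by
    rw [wordsOfDegree, Submodule.span_le]
    rintro _ ⟨w, rfl, rfl⟩
    exact key w
  exact this hx

end CommRel

/-! ### Change of coefficients -/

section BaseChange

variable {R S : Type} [CommRing R] [CommRing S] {n : ℕ} (φ : R →+* S)

/-- The map of free algebras that applies a ring homomorphism to all coefficients. -/
noncomputable def mapFree (φ : R →+* S) : FreeAlg R n →+* FreeAlg S n :=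
  MonoidAlgebra.mapRingHom _ φ

@[simp] theorem coeff_mapFree (f : FreeAlg R n) (w : FreeMonoid (Fin n)) :
    (mapFree φ f).coeff w = φ (f.coeff w) :=
  MonoidAlgebra.coeff_mapRingHom ..

@[simp] theorem mapFree_word (w : FreeMonoid (Fin n)) : mapFree φ (word R w) = word S w := by
  simp [mapFree, word]

@[simp] theorem mapFree_smul (c : R) (f : FreeAlg R n) : mapFree φ (c • f) = φ c • mapFree φ f := by
  ext w
  simp [MonoidAlgebra.coeff_smul]

@[simp] theorem mapFree_stdToFree (P : StdPoly R n) :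
    mapFree φ (stdToFree R n P) = stdToFree S n (MvPolynomial.map φ P) := by
  rw [MvPolynomial.as_sum P]
  simp only [map_sum, MvPolynomial.map_monomial, stdToFree_monomial, mapFree_smul, mapFree_word]

theorem mapFree_injective (hφ : Function.Injective φ) :
    Function.Injective (mapFree (n := n) φ) := by
  intro x y h
  ext w
  apply hφ
  rw [← coeff_mapFree, ← coeff_mapFree, h]

theorem mapFree_surjective (hφ : Function.Surjective φ) :
    Function.Surjective (mapFree (n := n) φ) := by
  intro x
  rw [← sum_coeff_smul_word x]
  choose g hg using hφ
  refine ⟨x.coeff.sum fun w c => g c • word R w, ?_⟩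
  simp [Finsupp.sum, hg]

namespace CommRel

variable {φ} {D : CommRel R n} {m : MonomialOrder (Fin n)}

theorem mapFree_rhs (i j : Fin n) : mapFree φ (D.rhs i j) = (D.map φ).rhs i j := by
  simp [rhs, CommRel.map]

theorem mapFree_nondegElem (i j k : Fin n) :
    mapFree φ (D.nondegElem i j k) = (D.map φ).nondegElem i j k := by
  simp [nondegElem, CommRel.map]

theorem mapFree_step_result (f : FreeAlg R n) (i j : Fin n) (u v : FreeMonoid (Fin n)) :
    mapFree φ (f - f.coeff (u * (FreeMonoid.of j * FreeMonoid.of i) * v) •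
      (word R u * (word R (FreeMonoid.of j * FreeMonoid.of i) - D.rhs i j) * word R v)) =
    mapFree φ f - (mapFree φ f).coeff (u * (FreeMonoid.of j * FreeMonoid.of i) * v) •
      (word S u * (word S (FreeMonoid.of j * FreeMonoid.of i) - (D.map φ).rhs i j) *
        word S v) := by
  simp [mapFree_rhs]

theorem ReducesToZero.map {f : FreeAlg R n} (h : D.ReducesToZero f) :
    (D.map φ).ReducesToZero (mapFree φ f) := by
  induction h using Relation.ReflTransGen.head_induction_on with
  | refl => rw [map_zero]; exact Relation.ReflTransGen.refl
  | head hs _ ih =>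
    obtain ⟨i, j, u, v, hij, rfl⟩ := hs
    exact Relation.ReflTransGen.head ⟨i, j, u, v, hij, mapFree_step_result ..⟩ ih

/-- A step from the image of f uses a coefficient of f and the mapped relations, so its result is
again an image and the whole chain lifts. Injectivity makes the lifted chain end at 0. -/
theorem ReducesToZero.of_map (hφ : Function.Injective φ) {f : FreeAlg R n}
    (h : (D.map φ).ReducesToZero (mapFree φ f)) : D.ReducesToZero f := by
  generalize hx : mapFree φ f = x at h
  induction h using Relation.ReflTransGen.head_induction_on generalizing f with
  | refl =>
    rw [(map_eq_zero_iff _ (mapFree_injective φ hφ)).1 hx]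
    exact Relation.ReflTransGen.refl
  | head hs _ ih =>
    obtain ⟨i, j, u, v, hij, rfl⟩ := hs
    subst hx
    exact Relation.ReflTransGen.head ⟨i, j, u, v, hij, rfl⟩ (ih (mapFree_step_result ..))

theorem OverlapsResolve.map (h : D.OverlapsResolve) : (D.map φ).OverlapsResolve :=
  fun i j k hij hjk => mapFree_nondegElem (φ := φ) (D := D) i j k ▸ (h i j k hij hjk).map

theorem OverlapsResolve.of_map (hφ : Function.Injective φ) (h : (D.map φ).OverlapsResolve) :
    D.OverlapsResolve := fun i j k hij hjk =>
  .of_map hφ (mapFree_nondegElem (φ := φ) (D := D) i j k ▸ h i j k hij hjk)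

theorem TailsLT.map (h : D.TailsLT m) : (D.map φ).TailsLT m :=
  fun i j hij α hα => h i j hij α (MvPolynomial.support_map_subset _ _ hα)

theorem TailsLT.of_map (hφ : Function.Injective φ) (h : (D.map φ).TailsLT m) : D.TailsLT m :=
  fun i j hij α hα => h i j hij α (by
    simpa only [CommRel.map, MvPolynomial.support_map_of_injective _ hφ] using hα)

theorem IsGraded.of_map (hφ : Function.Injective φ) {ω : Fin n → ℕ} (h : (D.map φ).IsGraded ω) :
    D.IsGraded ω := fun i j hij α hα => h i j hij (by
  simpa only [CommRel.map, MvPolynomial.coeff_map, ne_eq, map_eq_zero_iff φ hφ] using hα)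

theorem Admissible.tailsLT (h : D.Admissible m) : D.TailsLT m := by
  intro i j hij α hα
  rcases h i j hij with h | h
  · simp [h] at hα
  · exact lt_of_le_of_lt (m.le_degree hα) h

theorem toAlg_mapFree_eq {x y : FreeAlg R n} (h : D.toAlg x = D.toAlg y) :
    (D.map φ).toAlg (mapFree φ x) = (D.map φ).toAlg (mapFree φ y) := by
  let F : FreeAlg R n →+* (D.map φ).Alg := ((D.map φ).toAlg : _ →+* _).comp (mapFree φ)
  have hF : ∀ ⦃x y⦄, D.Rel x y → F x = F y := by
    rintro _ _ ⟨i, j, hij⟩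
    have := toAlg_relator (D := D.map φ) hij
    rw [relator, map_sub, sub_eq_zero] at this
    simpa [F, mapFree_rhs] using this
  have hx (z : FreeAlg R n) : D.toAlg z = RingQuot.mkRingHom D.Rel z := by
    rw [← RingQuot.mkAlgHom_coe R]
    rfl
  rw [hx, hx] at h
  have := congrArg (RingQuot.lift ⟨F, hF⟩) h
  rwa [RingQuot.lift_mkRingHom_apply, RingQuot.lift_mkRingHom_apply] at this

theorem TailsLT.ofStd_map_normalForm (hD : D.TailsLT m) (x : FreeAlg R n) :
    (D.map φ).ofStd (MvPolynomial.map φ (D.normalForm m x)) = (D.map φ).toAlg (mapFree φ x) := by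
  rw [ofStd_apply, ← mapFree_stdToFree]
  exact toAlg_mapFree_eq (hD.toAlg_normalForm x)

/-! ### Homogeneous integral lifts -/

/-- The integral standard polynomials all of whose `ω`-homogeneous components map into the left
ideal generated by `f_1, …, f_r`, whatever the coefficient ring. -/
noncomputable def homogeneousLifts (C : CommRel ℤ n) (ω : Fin n → ℕ) {r : ℕ}
    (f : Fin r → StdPoly ℤ n) : Submodule ℤ (StdPoly ℤ n) where
  carrier := {P | ∀ (R : Type) [CommRing R] (e : ℕ), (C.baseChange R).ofStd
    (MvPolynomial.map (Int.castRingHom R) (MvPolynomial.weightedHomogeneousComponent ω e P)) ∈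
      C.leftIdeal R f}
  zero_mem' := by simp
  add_mem' := by
    intro a b ha hb R _ e
    simp only [map_add]
    exact add_mem (ha R e) (hb R e)
  smul_mem' := by
    intro c a ha R _ e
    simp only [map_zsmul]
    exact zsmul_mem (ha R e) c

variable {C : CommRel ℤ n} {ω : Fin n → ℕ} {r : ℕ} {f : Fin r → StdPoly ℤ n}

/-- By linearity y may be taken to be a word. Then y f_j and its normal form are homogeneous, so
each component is either 0 or the whole normal form, which represents a left multiple of f_j over
every ring. -/
theorem TailsLT.normalForm_mul_mem_homogeneousLifts (hC : C.TailsLT m) (hω : C.IsGraded ω)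
    (hf : ∀ j, ∃ e : ℕ, MvPolynomial.IsWeightedHomogeneous ω (f j) e)
    (y : FreeAlg ℤ n) (j : Fin r) :
    C.normalForm m (y * stdToFree ℤ n (f j)) ∈ C.homogeneousLifts ω f := by
  obtain ⟨e, he⟩ := hf j
  rw [← sum_coeff_smul_word y, Finsupp.sum, Finset.sum_mul, map_sum]
  refine Submodule.sum_mem _ fun w _ => ?_
  rw [smul_mul_assoc, map_smul]
  refine Submodule.smul_mem _ _ fun R _ e' => ?_
  have h1 := word_mul_mul_mem_wordsOfDegree (stdToFree_mem_wordsOfDegree he) w 1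
  rw [word_one, mul_one] at h1
  have h2 := hC.isWeightedHomogeneous_normalForm hω h1
  classical
  rw [MvPolynomial.weightedHomogeneousComponent_of_mem h2]
  split_ifs
  · rw [hC.ofStd_map_normalForm, map_mul, map_mul, mapFree_stdToFree]
    exact Ideal.mul_mem_left _ _ (Ideal.subset_span ⟨j, rfl⟩)
  · simp

/-- The multipliers of the f_j lift to the free algebra over ℤ, and the normal form is taken there.
With R = ℤ/p this yields one integral polynomial that gives h modulo p and whose components also lie
in I over ℚ. -/
theorem TailsLT.exists_homogeneousLift (hC : C.TailsLT m) (hω : C.IsGraded ω)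
    (hf : ∀ j, ∃ e : ℕ, MvPolynomial.IsWeightedHomogeneous ω (f j) e)
    (hR : Function.Surjective (Int.castRingHom R)) {h : (C.baseChange R).Alg}
    (hh : h ∈ C.leftIdeal R f) : ∃ P ∈ C.homogeneousLifts ω f,
      (C.baseChange R).ofStd (MvPolynomial.map (Int.castRingHom R) P) = h := by
  rw [leftIdeal, Ideal.span, Submodule.mem_span_range_iff_exists_fun] at hh
  obtain ⟨a, rfl⟩ := hh
  have ha (j : Fin r) : ∃ y : FreeAlg ℤ n,
      (C.baseChange R).toAlg (mapFree (Int.castRingHom R) y) = a j := by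
    obtain ⟨x, hx⟩ := toAlg_surjective (a j)
    obtain ⟨y, rfl⟩ := mapFree_surjective _ hR x
    exact ⟨y, hx⟩
  choose y hy using ha
  refine ⟨∑ j, C.normalForm m (y j * stdToFree ℤ n (f j)), Submodule.sum_mem _ fun j _ =>
    hC.normalForm_mul_mem_homogeneousLifts hω hf (y j) j, ?_⟩
  rw [map_sum, map_sum]
  refine Finset.sum_congr rfl fun j _ => ?_
  rw [hC.ofStd_map_normalForm, map_mul, map_mul, mapFree_stdToFree, hy]
  rfl

end CommRel

end BaseChange

/-! ### Counting leading exponents -/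

section Counting

variable {n : ℕ} {m : MonomialOrder (Fin n)}

/-- Triangularity modulo p: among the indices with a α not divisible by p take the largest, γ.
Modulo p, only the γ-th summand contributes to the coefficient at γ. -/
theorem dvd_of_sum_smul_eq_zero {p : ℕ} [Fact p.Prime] {S : Finset (Fin n →₀ ℕ)}
    {P : S → StdPoly ℤ n} (h1 : ∀ α : S, (((P α).coeff α : ℤ) : ZMod p) ≠ 0)
    (h2 : ∀ (α : S) (β : Fin n →₀ ℕ), (((P α).coeff β : ℤ) : ZMod p) ≠ 0 → m.toSyn β ≤ m.toSyn α)
    {a : S → ℤ} (ha : ∑ α, a α • P α = 0) (α : S) : (p : ℤ) ∣ a α := by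
  classical
  by_contra hα
  obtain ⟨γ, hγ, hmax⟩ := (Finset.univ.filter fun α => ¬ (p : ℤ) ∣ a α).exists_max_image
    (fun α => m.toSyn α.1) ⟨α, by simpa using hα⟩
  simp only [Finset.mem_filter, Finset.mem_univ, true_and] at hγ hmax
  have h := congrArg (fun x => ((MvPolynomial.coeff γ.1 x : ℤ) : ZMod p)) ha
  simp only [MvPolynomial.coeff_sum, MvPolynomial.coeff_smul, smul_eq_mul, Int.cast_sum,
    Int.cast_mul, MvPolynomial.coeff_zero, Int.cast_zero] at h
  rw [Finset.sum_eq_single γ] at h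
  · rcases mul_eq_zero.1 h with h | h
    · exact hγ ((ZMod.intCast_zmod_eq_zero_iff_dvd _ _).1 h)
    · exact h1 γ h
  · intro β _ hβ
    by_cases hd : (p : ℤ) ∣ a β
    · rw [(ZMod.intCast_zmod_eq_zero_iff_dvd _ _).2 hd, zero_mul]
    · rw [mul_eq_zero]
      right
      by_contra hc
      exact hβ (Subtype.ext (m.toSyn.injective (le_antisymm (hmax β hd) (h2 β _ hc))))
  · simp

/-- Over ℤ the family need not be triangular: P α may have terms above α with coefficients divisible
by p. Instead, a relation can be divided by p again and again, so every power of p divides its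
coefficients. -/
theorem eq_zero_of_sum_smul_eq_zero {p : ℕ} [Fact p.Prime] {S : Finset (Fin n →₀ ℕ)}
    {P : S → StdPoly ℤ n} (h1 : ∀ α : S, (((P α).coeff α : ℤ) : ZMod p) ≠ 0)
    (h2 : ∀ (α : S) (β : Fin n →₀ ℕ), (((P α).coeff β : ℤ) : ZMod p) ≠ 0 → m.toSyn β ≤ m.toSyn α)
    {a : S → ℤ} (ha : ∑ α, a α • P α = 0) (α : S) : a α = 0 := by
  have hp : (p : ℤ) ≠ 0 := by exact_mod_cast (Fact.out : p.Prime).ne_zero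
  have key (k : ℕ) : ∀ a : S → ℤ, ∑ α, a α • P α = 0 → (p : ℤ) ^ k ∣ a α := by
    induction k with
    | zero => simp
    | succ k ih =>
      intro a ha
      choose b hb using dvd_of_sum_smul_eq_zero h1 h2 ha
      have h0 : (p : ℤ) • ∑ α, b α • P α = 0 := by
        rw [Finset.smul_sum, ← ha]
        exact Finset.sum_congr rfl fun α _ => by rw [smul_smul, ← hb]
      rw [hb α, pow_succ']
      exact mul_dvd_mul_left _ (ih b ((smul_eq_zero.1 h0).resolve_left hp))
  by_contra hne
  have hf : FiniteMultiplicity (p : ℤ) (a α) := Int.finiteMultiplicity_iff.2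
    ⟨by simpa using (Fact.out : p.Prime).ne_one, hne⟩
  exact hf.not_pow_dvd_of_multiplicity_lt (Nat.lt_succ_self _) (key _ a ha)

/-- By `h3`, a combination whose coordinates in T all vanish is zero, so the family stays
independent after projection to ℤ^T. -/
theorem card_le_card_of_integral_family {p : ℕ} [Fact p.Prime] {S T : Finset (Fin n →₀ ℕ)}
    {P : S → StdPoly ℤ n} (h1 : ∀ α : S, (((P α).coeff α : ℤ) : ZMod p) ≠ 0)
    (h2 : ∀ (α : S) (β : Fin n →₀ ℕ), (((P α).coeff β : ℤ) : ZMod p) ≠ 0 → m.toSyn β ≤ m.toSyn α)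
    (h3 : ∀ a : S → ℤ, ∑ α, a α • P α ≠ 0 → ∃ β ∈ T, (∑ α, a α • P α).coeff β ≠ 0) :
    S.card ≤ T.card := by
  have hli : LinearIndependent ℤ fun (α : S) (β : T) => (P α).coeff β := by
    rw [Fintype.linearIndependent_iff]
    intro a ha
    refine eq_zero_of_sum_smul_eq_zero h1 h2 ?_
    by_contra hne
    obtain ⟨β, hβ, hc⟩ := h3 a hne
    apply hc
    simpa only [MvPolynomial.coeff_sum, MvPolynomial.coeff_smul, Finset.sum_apply, Pi.smul_apply,
      Pi.zero_apply] using congrFun ha ⟨β, hβ⟩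
  simpa using hli.fintype_card_le_finrank

/-- Cancel the leading term of x by a scalar multiple of y and induct on the degree. Only linear
structure is used, so the result transfers to the noncommutative algebra through `ofStd`. -/
theorem Submodule.le_of_degree_mem {K : Type} [Field K] {M N : Submodule K (StdPoly K n)}
    (hMN : M ≤ N) (h : ∀ x ∈ N, x ≠ 0 → ∃ y ∈ M, y ≠ 0 ∧ m.degree y = m.degree x) : N ≤ M := by
  intro x hx
  generalize ht : m.toSyn (m.degree x) = t
  induction t using WellFoundedLT.induction generalizing x with
  | _ t ih =>
    by_cases hx0 : x = 0
    · exact hx0 ▸ M.zero_mem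
    obtain ⟨y, hy, hy0, hxy⟩ := h x hx hx0
    set c := m.leadingCoeff x / m.leadingCoeff y
    have hlc : m.leadingCoeff y ≠ 0 := m.leadingCoeff_ne_zero_iff.2 hy0
    have hz : x - c • y ∈ M := by
      by_cases hz0 : x - c • y = 0
      · exact hz0 ▸ M.zero_mem
      refine ih _ ?_ (N.sub_mem hx (N.smul_mem _ (hMN hy))) rfl
      rw [← ht]
      have hc : (x - c • y).coeff (m.degree x) = 0 := by
        rw [MvPolynomial.coeff_sub, MvPolynomial.coeff_smul, ← hxy]
        change _ - c * m.leadingCoeff y = 0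
        rw [div_mul_cancel₀ _ hlc, hxy, MonomialOrder.leadingCoeff, sub_self]
      refine lt_of_le_of_ne ?_ fun he => ?_
      · rw [m.degree_le_iff]
        intro β hβ
        by_contra hlt
        rw [not_le] at hlt
        rw [MvPolynomial.mem_support_iff, MvPolynomial.coeff_sub, MvPolynomial.coeff_smul,
          m.coeff_eq_zero_of_lt hlt, m.coeff_eq_zero_of_lt (hxy ▸ hlt)] at hβ
        simp at hβ
      · rw [← m.toSyn.injective he] at hc
        exact m.coeff_degree_ne_zero_iff.2 hz0 hc
    simpa using M.add_mem hz (M.smul_mem c hy)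

end Counting

/-! ### Comparison of exponents over ℚ and modulo p -/

namespace CommRel

theorem stdRep_ofStd {R : Type} [CommRing R] {n : ℕ} {D : CommRel R n}
    (h : Function.Injective D.ofStd) (P : StdPoly R n) : D.stdRep (D.ofStd P) = P :=
  Function.leftInverse_invFun h P

variable {n : ℕ} {C : CommRel ℤ n} {m : MonomialOrder (Fin n)}

theorem expSet_leftIdeal_subset (hC : C.TailsLT m) (hO : C.OverlapsResolve)
    {ω : Fin n → ℕ} (hω : ∀ i, 1 ≤ ω i) (hgr : C.IsGraded ω) {r : ℕ} {f : Fin r → StdPoly ℤ n}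
    (hf : ∀ j, ∃ e : ℕ, MvPolynomial.IsWeightedHomogeneous ω (f j) e) {p : ℕ} (hp : p.Prime)
    (h : (C.baseChange ℚ).expSet m (C.leftIdeal ℚ f) ⊆
      (C.baseChange (ZMod p)).expSet m (C.leftIdeal (ZMod p) f)) :
    (C.baseChange (ZMod p)).expSet m (C.leftIdeal (ZMod p) f) ⊆
      (C.baseChange ℚ).expSet m (C.leftIdeal ℚ f) := by
  classical
  have := Fact.mk hp
  intro α₀ hα₀
  set E := (C.baseChange (ZMod p)).expSet m (C.leftIdeal (ZMod p) f)
  set E' := (C.baseChange ℚ).expSet m (C.leftIdeal ℚ f)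
  have injQ := ((hC.map (φ := Int.castRingHom ℚ)).ofStd_bijective hO.map).1
  have bijP := (hC.map (φ := Int.castRingHom (ZMod p))).ofStd_bijective hO.map
  let e := Finsupp.weight ω α₀
  have hfin : {α : Fin n →₀ ℕ | Finsupp.weight ω α = e}.Finite :=
    Finsupp.finite_of_nat_weight_eq ω (fun i => Nat.one_le_iff_ne_zero.1 (hω i)) e
  let S := hfin.toFinset.filter (· ∈ E)
  let T := hfin.toFinset.filter (· ∈ E')
  have hS (α : S) : ∃ P : StdPoly ℤ n, MvPolynomial.IsWeightedHomogeneous ω P e ∧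
      (C.baseChange ℚ).ofStd (MvPolynomial.map (Int.castRingHom ℚ) P) ∈ C.leftIdeal ℚ f ∧
      ((P.coeff α : ℤ) : ZMod p) ≠ 0 ∧
      ∀ β : Fin n →₀ ℕ, ((P.coeff β : ℤ) : ZMod p) ≠ 0 → m.toSyn β ≤ m.toSyn α.1 := by
    obtain ⟨α, hα⟩ := α
    rw [Finset.mem_filter, Set.Finite.mem_toFinset] at hα
    obtain ⟨he, g, hg, hg0, hgα⟩ := hα
    obtain ⟨P, hP, rfl⟩ := hC.exists_homogeneousLift hgr hf (ZMod.ringHom_surjective _) hg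
    rw [exp, stdRep_ofStd bijP.1] at hgα
    have hP0 : MvPolynomial.map (Int.castRingHom (ZMod p)) P ≠ 0 := by
      rintro h0
      exact hg0 (by rw [h0, map_zero])
    -- Passing to degree e keeps the coefficient at α, since α has degree e. The terms that survive
    -- modulo p are among those of the element lifted, hence at most α.
    refine ⟨MvPolynomial.weightedHomogeneousComponent ω e P,
      MvPolynomial.weightedHomogeneousComponent_isWeightedHomogeneous e P, hP ℚ e, ?_, ?_⟩
    · rw [MvPolynomial.coeff_weightedHomogeneousComponent,
        if_pos (show Finsupp.weight ω α = e from he)]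
      have := m.coeff_degree_ne_zero_iff.2 hP0
      rwa [hgα, MvPolynomial.coeff_map] at this
    · intro β hβ
      rw [MvPolynomial.coeff_weightedHomogeneousComponent] at hβ
      split_ifs at hβ
      · change m.toSyn β ≤ m.toSyn α
        rw [← hgα]
        refine m.le_degree ?_
        rwa [MvPolynomial.mem_support_iff, MvPolynomial.coeff_map]
      · simp at hβ
  choose P hPe hPI hP1 hP2 using hS
  have hcard : S.card ≤ T.card := by
    refine card_le_card_of_integral_family hP1 hP2 fun a ha => ?_
    set x := ∑ α, a α • P α with hx
    have hxe : x ∈ MvPolynomial.weightedHomogeneousSubmodule ℤ ω e :=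
      Submodule.sum_mem _ fun α _ => Submodule.smul_mem _ _ (hPe α)
    have hxI : (C.baseChange ℚ).ofStd (MvPolynomial.map (Int.castRingHom ℚ) x) ∈
        C.leftIdeal ℚ f := by
      rw [hx, map_sum, map_sum]
      refine Submodule.sum_mem _ fun α _ => ?_
      rw [map_zsmul, map_zsmul]
      exact zsmul_mem (hPI α) _
    have hx0 : MvPolynomial.map (Int.castRingHom ℚ) x ≠ 0 := fun h0 =>
      ha (MvPolynomial.map_injective _ Int.cast_injective (h0.trans (map_zero _).symm))
    have hxc := m.coeff_degree_ne_zero_iff.2 hx0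
    rw [MvPolynomial.coeff_map] at hxc
    have hxc' : x.coeff (m.degree (MvPolynomial.map (Int.castRingHom ℚ) x)) ≠ 0 :=
      fun h0 => hxc (by rw [h0, map_zero])
    -- The witness is the leading exponent of x over ℚ. It has degree e because x is homogeneous,
    -- and x lies in I, so it belongs to T.
    refine ⟨_, ?_, hxc'⟩
    rw [Finset.mem_filter, Set.Finite.mem_toFinset]
    exact ⟨hxe hxc', _, hxI, (map_ne_zero_iff _ injQ).2 hx0, by rw [exp, stdRep_ofStd injQ]⟩
  have hTS : T ⊆ S := Finset.monotone_filter_right _ fun _ _ hα => h hα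
  have hmem : α₀ ∈ S := by
    rw [Finset.mem_filter, Set.Finite.mem_toFinset]
    exact ⟨rfl, hα₀⟩
  rw [← Finset.eq_of_subset_of_card_le hTS hcard] at hmem
  exact (Finset.mem_filter.1 hmem).2

theorem ideal_le_of_expSet_subset {K : Type} [Field K] {D : CommRel K n}
    (hD : Function.Bijective D.ofStd) {I J : Ideal D.Alg} (hIJ : I ≤ J)
    (h : D.expSet m J ⊆ D.expSet m I) : J ≤ I := by
  have key : (J.restrictScalars K).comap D.ofStd ≤ (I.restrictScalars K).comap D.ofStd := by
    refine Submodule.le_of_degree_mem (m := m) (fun x hx => hIJ hx) fun x hx hx0 => ?_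
    obtain ⟨g, hg, hg0, hgx⟩ := h ⟨_, hx, (map_ne_zero_iff _ hD.1).2 hx0, rfl⟩
    obtain ⟨y, rfl⟩ := hD.2 g
    rw [exp, exp, stdRep_ofStd hD.1, stdRep_ofStd hD.1] at hgx
    exact ⟨y, hg, fun h0 => hg0 (by rw [h0, map_zero]), hgx⟩
  intro g hg
  obtain ⟨y, rfl⟩ := hD.2 g
  exact key hg

end CommRel

theorem theorem3p9 {n : ℕ} (C : CommRel ℤ n) (hA : (C.baseChange ℚ).IsGAlgebra)
    (m : MonomialOrder (Fin n)) (hm : (C.baseChange ℚ).Admissible m)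
    (ω : Fin n → ℕ) (hω : ∀ i, 1 ≤ ω i) (hgr : (C.baseChange ℚ).IsGraded ω)
    {r : ℕ} (f : Fin r → StdPoly ℤ n)
    (hf : ∀ j, ∃ e : ℕ, MvPolynomial.IsWeightedHomogeneous ω (f j) e)
    (I : Ideal (C.baseChange ℚ).Alg) (hI : I = C.leftIdeal ℚ f)
    (G : Finset (C.baseChange ℚ).Alg)
    (h1 : ∃ p : ℕ, p.Prime ∧ C.DividesNoCoeff p ∧
      ∃ Gp : Finset (C.baseChange (ZMod p)).Alg,
        (C.baseChange (ZMod p)).IsReducedGroebnerBasisFor m Gp (C.leftIdeal (ZMod p) f) ∧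
        (C.baseChange ℚ).exp m '' (G : Set (C.baseChange ℚ).Alg)
          = (C.baseChange (ZMod p)).exp m '' (Gp : Set (C.baseChange (ZMod p)).Alg))
    (h2 : (C.baseChange ℚ).IsLeftGroebnerBasis m G)
    (h3 : I ≤ Ideal.span (G : Set (C.baseChange ℚ).Alg)) :
    (C.baseChange ℚ).IsGroebnerBasisFor m G I := by
  obtain ⟨p, hp, -, Gp, ⟨⟨-, hGp⟩, -⟩, hG⟩ := h1
  subst hI
  have hinj : Function.Injective (Int.castRingHom ℚ) := Int.cast_injective
  -- Admissibility and nondegeneracy descend from ℚ to ℤ, from where they pass to ℤ/p.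
  have hC : C.TailsLT m := .of_map hinj hm.tailsLT
  have hO : C.OverlapsResolve := .of_map hinj hA.nondegenerate
  have hE : (C.baseChange ℚ).expSet m (Ideal.span (G : Set (C.baseChange ℚ).Alg)) =
      (C.baseChange (ZMod p)).expSet m (C.leftIdeal (ZMod p) f) := by
    rw [h2.2, hGp]
    have e1 := Set.biUnion_image (s := (G : Set (C.baseChange ℚ).Alg))
      (f := (C.baseChange ℚ).exp m) (g := fun α => Set.range fun β : Fin n →₀ ℕ => α + β)
    rw [hG, Set.biUnion_image] at e1
    exact e1.symm
  have hsub : (C.baseChange ℚ).expSet m (C.leftIdeal ℚ f) ⊆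
      (C.baseChange ℚ).expSet m (Ideal.span (G : Set (C.baseChange ℚ).Alg)) :=
    fun _ ⟨g, hg, h⟩ => ⟨g, h3 hg, h⟩
  have hsup := CommRel.expSet_leftIdeal_subset hC hO hω (.of_map hinj hgr) hf hp (hE ▸ hsub)
  have heq := h3.antisymm (CommRel.ideal_le_of_expSet_subset (hC.map.ofStd_bijective hO.map) h3
    (hE ▸ hsup))
  rw [heq]
  exact h2
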